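/- Let $D$ be an $n$-component virtual link diagram: an immersion of $n$ ordered oriented circles into the oriented plane whose only singularities are finitely many transverse double points, each marked as a classical crossing (with over- and under-information) or as a virtual crossing. An arc of $D$ is a segment along $D$ going from a classical under-crossing to the next one. A base point system is $\mathbf p=(p_1,\dots,p_n)$ with $p_i$ a point of the $i$th component away from all crossings; $\mathcal P$ is the set of all of them, and $\mathcal P_0\subset\mathcal P$ is the set of those for which every $p_i$ lies on a segment that starts at a classical under-crossing and meets no further classical crossing (over or under) before $p_i$. Assume that every component has a classical under-crossing (this is so if $\mathcal P_0\neq\emptyset$), choose an arc $a_{i1}$ on each component, and let $a_{i1},a_{i2},\dots,a_{im_i}$ be the arcs of the $i$th component in order along the orientation. Let $\varepsilon_{ij}$ be the sign of the crossing at the end of $a_{ij}$, and let $w_i$ be the sum of the signs of the classical self-crossings of the $i$th component. For $\mathbf p\in\mathcal P$ let $\mathbf p(i)$ be the index with $p_i\in a_{i\mathbf p(i)}$. The point $p_i$ divides this arc; its part before $p_i$ is labelled $b_i^{\mathbf p}$ and its part after $p_i$ keeps the label $a_{i\mathbf p(i)}$. Let $\overline A$ be the free group on the labels $a_{ij},b_i^{\mathbf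 p}$, let $A$ be the free group on $\alpha_1,\dots,\alpha_n$, and let $u_{ij}$ be the label of the arc of $(D,\mathbf p)$ that passes over the end of $a_{ij}$. Put $$v_{ij}^{\mathbf p}=\begin{cases}u_{i\mathbf p(i)}^{\varepsilon_{i\mathbf p(i)}}\cdots u_{ij}^{\varepsilon_{ij}} & (\mathbf p(i)\le j\le m_i),\\ u_{i\mathbf p(i)}^{\varepsilon_{i\mathbf p(i)}}\cdots u_{im_i}^{\varepsilon_{im_i}}u_{i1}^{\varepsilon_{i1}}\cdots u_{ij}^{\varepsilon_{ij}} & (1\le j\le \mathbf p(i)-1),\end{cases}\qquad v_{i0}^{\mathbf p}=v_{im_i}^{\mathbf p},$$ $$l_i^{\mathbf p}=a_{i\mathbf p(i)}^{-w_i}v_{i\,\mathbf p(i)-1}^{\mathbf p},\qquad \lambda_i^{\mathbf p}=u_{i1}^{\varepsilon_{i1}}\cdots u_{i\,\mathbf p(i)-1}^{\varepsilon_{i\,\mathbf p(i)-1}}\quad(\lambda_i^{\mathbf p}=1\text{ if }\mathbf p(i)=1).$$ Define homomorphisms $\eta_q^{\mathbf p}:\overline A\to A$ ($q\ge1$) by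 $\eta_1^{\mathbf p}(a_{ij})=\eta_1^{\mathbf p}(b_i^{\mathbf p})=\alpha_i$, $\eta_{q+1}^{\mathbf p}(a_{i\mathbf p(i)})=\alpha_i$, $$\eta_{q+1}^{\mathbf p}(a_{ij})=\eta_q^{\mathbf p}(v_{i\,j-1}^{\mathbf p})^{-1}\alpha_i\,\eta_q^{\mathbf p}(v_{i\,j-1}^{\mathbf p})\ (j\ne\mathbf p(i)),\qquad \eta_{q+1}^{\mathbf p}(b_i^{\mathbf p})=\eta_q^{\mathbf p}(v_{i\,\mathbf p(i)-1}^{\mathbf p})^{-1}\alpha_i\,\eta_q^{\mathbf p}(v_{i\,\mathbf p(i)-1}^{\mathbf p}),$$ and homomorphisms $\phi_q^{\mathbf p}:A\to A$ by $\phi_1^{\mathbf p}(\alpha_i)=\alpha_i$ and $\phi_q^{\mathbf p}(\alpha_i)=\eta_{q-1}^{\mathbf p}(\lambda_i^{\mathbf p})\,\alpha_i\,\eta_{q-1}^{\mathbf p}(\lambda_i^{\mathbf p})^{-1}$ for $q\ge2$. Fix $\mathbf p_*\in\mathcal P_0$ whose points lie on the arcs $a_{11},\dots,a_{n1}$, and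 write $\eta_q=\eta_q^{\mathbf p_*}$, $l_i=l_i^{\mathbf p_*}$. (For $\mathbf p\in\mathcal P_0$ no letter $b_k^{\mathbf p}$ occurs in the words above, so $\eta_q(\lambda_i^{\mathbf p})$ makes sense.) Let $A_q$ be the $q$th term of the lower central series of $A$, with $A_1=A$, let $M_q^{\mathbf p}$ be the normal closure of $\{\phi_q^{\mathbf p}([\alpha_i,\eta_q(l_i)])\mid 1\le i\le n\}$ in $A$, where $[x,y]=xyx^{-1}y^{-1}$, and let $M_q=\prod_{\mathbf p\in\mathcal P_0}M_q^{\mathbf p}$. **Theorem.** Let $\mathbf p\in\mathcal P$, and let $\mathbf p_0\in\mathcal P_0$ satisfy $\mathbf p_0(k)=\mathbf p(k)$ for $1\le k\le n$. For every $q\ge1$ and every $1\le i\le n$, $$\eta_q^{\mathbf p}(l_i^{\mathbf p})\equiv\phi_q^{\mathbf p_0}\bigl(\eta_q((\lambda_i^{\mathbf p_0})^{-1}\,l_i\,\lambda_i^{\mathbf p_0})\bigr)\pmod{A_qM_q^{\mathbf p_0}},$$ and hence the same congruence holds modulo $A_qM_q$. -/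

import Mathlib

open scoped ContDiff

noncomputable section

/-- A point of the disjoint union of `n` ordered circles `ℝ / ℤ`, each with its usual orientation. -/
abbrev StrandPoint (n : ℕ) : Type := Fin n × UnitAddCircle

/-- The velocity vector at `x` of a map from `n` circles to the plane `ℂ = ℝ²`. -/
def velocity {n : ℕ} (curve : StrandPoint n → ℂ) (x : StrandPoint n) : ℂ :=
  deriv (fun t : ℝ => curve (x.1, x.2 + (t : UnitAddCircle))) 0

/-- An `n`-component virtual link diagram: an immersion of `n` ordered oriented circles into the
plane whose singularities are finitely many transverse double points, together with the set of
those points of the circles that are the lower points of classical crossings.  A double point with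
one lower preimage is a classical crossing, a double point with none is a virtual crossing. -/
structure VirtualLinkDiagram (n : ℕ) where
  curve : StrandPoint n → ℂ
  smooth : ∀ i, ContDiff ℝ ∞ (fun t : ℝ => curve (i, (t : UnitAddCircle)))
  immersed : ∀ x, velocity curve x ≠ 0
  finite_double : {x | ∃ y, y ≠ x ∧ curve y = curve x}.Finite
  no_triple : ∀ x y z, curve x = curve y → curve y = curve z → x = y ∨ y = z ∨ x = z
  transverse : ∀ x y, x ≠ y → curve x = curve y →
    LinearIndependent ℝ ![velocity curve x, velocity curve y]
  under : Set (StrandPoint n)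
  under_double : ∀ x ∈ under, ∃ y, y ≠ x ∧ curve y = curve x
  under_unique : ∀ x ∈ under, ∀ y, y ≠ x → curve y = curve x → y ∉ under

/-- The distance travelled along the oriented circle `ℝ / ℤ` from `x` to `y`, a number in `(0, 1]`
(so that it is `1` if `y = x`). -/
def travel (x y : UnitAddCircle) : ℝ := (AddCircle.equivIoc (1 : ℝ) 0 (y - x)).1

theorem travel_injective (x : UnitAddCircle) : Function.Injective (travel x) := fun y z h => by
  have h' := (AddCircle.equivIoc (1 : ℝ) 0).injective (Subtype.ext h)
  exact sub_left_injective h'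

theorem travel_self (x : UnitAddCircle) : travel x x = 1 := by
  have h : (((1 : ℝ) : ℝ) : UnitAddCircle) = x - x := by
    rw [sub_self]; exact AddCircle.coe_period (1 : ℝ)
  have h1 : (1 : ℝ) ∈ Set.Ioc (0 : ℝ) (0 + 1) := by norm_num
  have h2 : (AddCircle.equivIoc (1 : ℝ) 0).symm ⟨1, h1⟩ = x - x := h
  unfold travel
  rw [← h2, Equiv.apply_symm_apply]

theorem travel_le_one (x y : UnitAddCircle) : travel x y ≤ 1 := by
  have := (AddCircle.equivIoc (1 : ℝ) 0 (y - x)).2.2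
  simpa [travel] using this

namespace VirtualLinkDiagram

variable {n : ℕ} (D : VirtualLinkDiagram n)

/-- The point of the circles that passes over the under-crossing point `x`, that is, the other
point with the same image (it is `x` itself if `x` is not over a double point). -/
def overPoint (x : StrandPoint n) : StrandPoint n :=
  open Classical in
  if h : ∃ y, y ≠ x ∧ D.curve y = D.curve x then h.choose else x

/-- `x` is a preimage of a classical crossing, as its lower or as its upper point. -/
def IsClassical (x : StrandPoint n) : Prop :=
  x ∈ D.under ∨ ∃ y ∈ D.under, y ≠ x ∧ D.curve y = D.curve x

/-- The sign of the classical crossing with lower point `x`: it is `1` if the direction of the upper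
strand followed by that of the lower strand is a positive basis of the plane, else `-1`. -/
def crossingSign (x : StrandPoint n) : ℤ :=
  let o := velocity D.curve (D.overPoint x)
  let u := velocity D.curve x
  if 0 < o.re * u.im - o.im * u.re then 1 else -1

theorem finite_under (i : Fin n) : {x : UnitAddCircle | (i, x) ∈ D.under}.Finite :=
  (D.finite_double.subset D.under_double).preimage
    (f := fun x : UnitAddCircle => ((i, x) : StrandPoint n))
    (fun _ _ _ _ h => (Prod.mk.inj h).2)

/-- The classical under-crossing points on the `i`th component. -/
def underPoints (i : Fin n) : Finset UnitAddCircle := (D.finite_under i).toFinset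

/-- `m_i`: the number of arcs of `D` on the `i`th component, which is the number of its classical
under-crossings (there is at least one wherever arcs are numbered, see `ArcNumbering`). -/
def numArcs (i : Fin n) : ℕ := (D.underPoints i).card

/-- `w_i`: the sum of the signs of the classical self-crossings of the `i`th component. -/
def selfWrithe (i : Fin n) : ℤ :=
  ∑ x ∈ (D.underPoints i).filter (fun x => (D.overPoint (i, x)).1 = i), D.crossingSign (i, x)

/-- The letters attached to the arcs: `a i j` is `a_{ij}` with `1 ≤ j ≤ m_i`, and `b i` is the
letter `b_i` of the additional arc that a base point on the `i`th component creates. -/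
inductive Letter : Type
  | a (i : Fin n) (j : Finset.Icc 1 (D.numArcs i))
  | b (i : Fin n)

/-- A base point system: a point on each component, away from all (classical or virtual)
crossings. -/
structure BasePointSystem where
  point : Fin n → UnitAddCircle
  not_crossing : ∀ i y, y ≠ (i, point i) → D.curve y ≠ D.curve (i, point i)

/-- The set `P₀` of the base point systems each of whose points lies on a semi-arc starting at a
classical under-crossing: between some classical under-crossing point and the base point there is
no preimage of a classical crossing. -/
def underStarting : Set D.BasePointSystem :=
  {p | ∀ i, ∃ c, (i, c) ∈ D.under ∧
    ∀ y, D.IsClassical (i, y) → ¬ travel c y < travel c (p.point i)}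

/-- A choice of the first arc `a_{i1}` on each component, given by the classical under-crossing
point at which this arc starts.  The other arcs of `D` are then numbered along the orientation. -/
structure ArcNumbering where
  start : Fin n → UnitAddCircle
  start_under : ∀ i, (i, start i) ∈ D.under

namespace ArcNumbering

variable {D} (N : D.ArcNumbering)

/-- The number `j` of the arc `a_{ij}` of `D` which contains the point `y` of the `i`th component:
one plus the number of under-crossings strictly between the start of `a_{i1}` and `y`. -/
def arcIndex (i : Fin n) (y : UnitAddCircle) : ℕ :=
  ((D.underPoints i).filter (fun x => travel (N.start i) x < travel (N.start i) y)).card + 1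

theorem arcIndex_mem (i : Fin n) (y : UnitAddCircle) :
    N.arcIndex i y ∈ Finset.Icc 1 (D.numArcs i) := by
  rw [Finset.mem_Icc]
  refine ⟨Nat.le_add_left _ _, Finset.card_lt_card ?_⟩
  refine Finset.filter_ssubset.2 ⟨N.start i, ?_, ?_⟩
  · simpa [underPoints] using N.start_under i
  · rw [travel_self]; exact not_lt.2 (travel_le_one _ _)

/-- The under-crossing point of the `i`th component at which `a_{ij}` ends and the next arc starts,
for `1 ≤ j ≤ m_i`: the `j`th one met when travelling from the start of `a_{i1}`, which is itself
met last. -/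
def crossingPoint (i : Fin n) (j : ℕ) : UnitAddCircle :=
  N.start i + (((((D.underPoints i).image (travel (N.start i))).sort (· ≤ ·)).getD (j - 1) 1 : ℝ) :
    UnitAddCircle)

/-- The sign `ε_{ij}` of the crossing at the end of `a_{ij}`. -/
def sign (i : Fin n) (j : ℕ) : ℤ := D.crossingSign (i, N.crossingPoint i j)

variable (p : D.BasePointSystem)

/-- `p(i)`: the number of the arc of `D` on which the `i`th base point lies. -/
def baseIndex (i : Fin n) : ℕ := N.arcIndex i (p.point i)

/-- The letter of the arc of `(D, p)` containing the point `y`, which is not an under-crossing.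
The base point `p_k` divides the arc number `p(k)` into `b_k`, before `p_k`, and `a_{k p(k)}`. -/
def arcLetter (y : StrandPoint n) : D.Letter :=
  open Classical in
  if N.arcIndex y.1 y.2 = N.baseIndex p y.1 ∧
      travel (N.start y.1) y.2 < travel (N.start y.1) (p.point y.1)
    then .b y.1 else .a y.1 ⟨N.arcIndex y.1 y.2, N.arcIndex_mem y.1 y.2⟩

/-- The letter `u_{ij}` of the arc of `(D, p)` which passes over the end of `a_{ij}`. -/
def overLetter (i : Fin n) (j : ℕ) : D.Letter :=
  N.arcLetter p (D.overPoint (i, N.crossingPoint i j))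

/-- The word `u_{ij}^{ε_{ij}} u_{i,j+1}^{ε_{i,j+1}} ⋯ u_{ik}^{ε_{ik}}`, which is empty if `k < j`. -/
def segmentWord (i : Fin n) (j k : ℕ) : FreeGroup D.Letter :=
  ((List.Ico j (k + 1)).map (fun s => FreeGroup.of (N.overLetter p i s) ^ N.sign i s)).prod

/-- The partial longitude `v_{ij}^p` for `0 ≤ j ≤ m_i`; its value at `j = 0` is `v_{i m_i}^p`. -/
def partialLongitude (i : Fin n) (j : ℕ) : FreeGroup D.Letter :=
  if N.baseIndex p i ≤ j then N.segmentWord p i (N.baseIndex p i) j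
  else N.segmentWord p i (N.baseIndex p i) (D.numArcs i) * N.segmentWord p i 1 j

/-- The preferred longitude `l_i^p = a_{i p(i)}^{-w_i} v_{i, p(i)-1}^p`. -/
def longitude (i : Fin n) : FreeGroup D.Letter :=
  FreeGroup.of (.a i ⟨N.baseIndex p i, N.arcIndex_mem i (p.point i)⟩) ^ (-D.selfWrithe i) *
    N.partialLongitude p i (N.baseIndex p i - 1)

/-- The word `λ_i^p = u_{i1}^{ε_{i1}} ⋯ u_{i,p(i)-1}^{ε_{i,p(i)-1}}`, which is `1` if `p(i) = 1`. -/
def connectingWord (i : Fin n) : FreeGroup D.Letter := N.segmentWord p i 1 (N.baseIndex p i - 1)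

/-- The homomorphisms `η_q^p` for `q ≥ 1` (the value at `q = 0` is a dummy). -/
def eta : ℕ → FreeGroup D.Letter →* FreeGroup (Fin n)
  | 0 => 1
  | 1 => FreeGroup.lift fun
      | .a i _ => FreeGroup.of i
      | .b i => FreeGroup.of i
  | q + 2 => FreeGroup.lift fun
      | .a i j =>
          if j.1 = N.baseIndex p i then FreeGroup.of i
          else (eta (q + 1) (N.partialLongitude p i (j.1 - 1)))⁻¹ * FreeGroup.of i *
            eta (q + 1) (N.partialLongitude p i (j.1 - 1))
      | .b i =>
          (eta (q + 1) (N.partialLongitude p i (N.baseIndex p i - 1)))⁻¹ * FreeGroup.of i *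
            eta (q + 1) (N.partialLongitude p i (N.baseIndex p i - 1))

/-- The homomorphisms `φ_q^p` for `q ≥ 1` (the value at `q = 0` is a dummy). -/
def phi : ℕ → FreeGroup (Fin n) →* FreeGroup (Fin n)
  | 0 => 1
  | 1 => FreeGroup.lift fun i => FreeGroup.of i
  | q + 2 => FreeGroup.lift fun i =>
      N.eta p (q + 1) (N.connectingWord p i) * FreeGroup.of i *
        N.eta p (q + 1) (N.connectingWord p i)⁻¹

/-- `pstar` is a base point system in `P₀` whose points lie on the arcs `a_{i1}`. -/
def IsReference (pstar : D.BasePointSystem) : Prop :=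
  pstar ∈ D.underStarting ∧ ∀ i, N.baseIndex pstar i = 1

/-- `M_q^p`: the normal closure of the elements `φ_q^p([α_i, η_q(l_i)])` for `1 ≤ i ≤ n`, where
`[x, y] = x y x⁻¹ y⁻¹` and `η_q`, `l_i` belong to the reference base point system. -/
def relSubgroup (pstar : D.BasePointSystem) (q : ℕ) (p : D.BasePointSystem) :
    Subgroup (FreeGroup (Fin n)) :=
  Subgroup.normalClosure
    {x | ∃ i, ∃ g, g = N.eta pstar q (N.longitude pstar i) ∧
      x = N.phi p q (FreeGroup.of i * g * (FreeGroup.of i)⁻¹ * g⁻¹)}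

/-- `M_q`: the product of the normal subgroups `M_q^p` over all `p` in `P₀`. -/
def totalRelSubgroup (pstar : D.BasePointSystem) (q : ℕ) : Subgroup (FreeGroup (Fin n)) :=
  ⨆ p ∈ D.underStarting, N.relSubgroup pstar q p

end ArcNumbering

end VirtualLinkDiagram

/-- `A_q`: the `q`th term of the lower central series of the free group of rank `n`, counted
from `A_1 = A`. -/
def freeLCS (n q : ℕ) : Subgroup (FreeGroup (Fin n)) :=
  (⊤ : Subgroup (FreeGroup (Fin n))).lowerCentralSeries (q - 1)

/-- `x ≡ y` modulo the subgroup `H`. -/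
def CongrMod {G : Type*} [Group G] (H : Subgroup G) (x y : G) : Prop := x⁻¹ * y ∈ H

end

open Subgroup QuotientGroup
open scoped commutatorElement

/-! Erasing the base points (`forgetBase`) turns words for `p` into words in the arcs of `D`, the
alphabet on which `η_q` and base points in `P₀` work. The core (`eta_mod_modulus`) is `η_q^p ≡
φ_q^{p₀} ∘ η_q ∘ forgetBase` modulo `A_q M_q^{p₀}`, by induction on `q`.

Fix `i`, put `s_j = u_{i1}^{ε_{i1}} ⋯ u_{ij}^{ε_{ij}}`, read in `A`, `L = s_{m_i}` and `β = φ(α_i) =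
s_{p(i)-1} α_i s_{p(i)-1}⁻¹`. The right side sends `a_{ij}` to `s_{j-1}⁻¹ β s_{j-1}`. On the left
`α_i` is conjugated by `s_{p(i)-1}⁻¹ s_{j-1}`, with the same result, or by `s_{p(i)-1}⁻¹ L s_{j-1}`
when the path passes the start of `a_{i1}`. The extra `L` is harmless because the relator makes it
commute with `β` (`commute_phi_longitude`).

The degree rises because conjugating by elements congruent modulo `A_q M_q` gives results congruent
modulo `A_{q+1} M_{q+1}` (`modulus_commutator_le`). Applied to `l_i^p`, the core yields `s⁻¹
α_i^{-w_i} L s` with `s = λ_i`, which is the claim. -/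

theorem coe_travel (x y : UnitAddCircle) : ((travel x y : ℝ) : UnitAddCircle) = y - x :=
  AddCircle.coe_equivIoc (p := (1 : ℝ)) (a := 0)

theorem travel_pos (x y : UnitAddCircle) : 0 < travel x y :=
  (AddCircle.equivIoc (1 : ℝ) 0 (y - x)).2.1

theorem travel_eq_of_coe_eq {x y : UnitAddCircle} {r : ℝ} (h0 : 0 < r) (h1 : r ≤ 1)
    (h : (r : UnitAddCircle) = y - x) : travel x y = r := by
  have hr : r ∈ Set.Ioc (0 : ℝ) (0 + 1) := ⟨h0, by simpa using h1⟩
  unfold travel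
  rw [← h, AddCircle.equivIoc_coe_eq hr]

theorem travel_eq_sub_of_lt {s x y : UnitAddCircle} (h : travel s x < travel s y) :
    travel x y = travel s y - travel s x := by
  refine travel_eq_of_coe_eq (by linarith)
    (by linarith [travel_le_one s y, travel_pos s x]) ?_
  rw [AddCircle.coe_sub, coe_travel, coe_travel]
  abel

theorem travel_eq_sub_add_one_of_le {s x y : UnitAddCircle} (h : travel s y ≤ travel s x) :
    travel x y = travel s y - travel s x + 1 := by
  refine travel_eq_of_coe_eq (by linarith [travel_le_one s x, travel_pos s y]) (by linarith) ?_
  rw [AddCircle.coe_add, AddCircle.coe_sub, coe_travel, coe_travel, AddCircle.coe_period]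
  abel

/-! ### Conjugation and congruences modulo normal subgroups. -/

section GroupTheory

variable {G : Type*} [Group G]

/-- The two conjugates differ by a conjugate of a commutator with `x⁻¹ * y ∈ H`. This is the step
that gains one degree in every induction below. -/
theorem mk_conj_eq_of_commutator_le {H K : Subgroup G} [H.Normal] [K.Normal]
    (hHK : ⁅H, (⊤ : Subgroup G)⁆ ≤ K) {x y : G} (h : mk' H x = mk' H y) (a : G) :
    mk' K (x⁻¹ * a * x) = mk' K (y⁻¹ * a * y) := by
  have hxy : x⁻¹ * y ∈ H := QuotientGroup.eq.1 h
  have hc := hHK (commutator_mem_commutator (H.inv_mem hxy) (mem_top (x⁻¹ * a * x)))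
  rw [commutatorElement_def] at hc
  refine (QuotientGroup.eq.2 ?_)
  have := (inferInstance : K.Normal).conj_mem _ hc (x⁻¹ * a * x)⁻¹
  convert this using 1
  group

theorem mk_eq_mk_of_le {H K : Subgroup G} [H.Normal] [K.Normal] (h : H ≤ K) {x y : G}
    (hxy : mk' H x = mk' H y) : mk' K x = mk' K y :=
  QuotientGroup.eq.2 (h (QuotientGroup.eq.1 hxy))

theorem lowerCentralSeries_mk_map_eq (f : G →* G) {k : ℕ} {x y : G}
    (h : mk' ((⊤ : Subgroup G).lowerCentralSeries k) x = mk' _ y) :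
    mk' ((⊤ : Subgroup G).lowerCentralSeries k) (f x) = mk' _ (f y) := by
  refine QuotientGroup.eq.2 ?_
  rw [← map_inv, ← map_mul]
  have h1 := mem_map_of_mem f (QuotientGroup.eq.1 h)
  rw [map_lowerCentralSeries] at h1
  exact lowerCentralSeries_mono k le_top h1

theorem lowerCentralSeries_commutator_le (k : ℕ) :
    ⁅(⊤ : Subgroup G).lowerCentralSeries k, (⊤ : Subgroup G)⁆ ≤
      (⊤ : Subgroup G).lowerCentralSeries (k + 1) := by
  rw [Subgroup.lowerCentralSeries_succ]

theorem inv_mul_mul_zpow (x y : G) (m : ℤ) : (x⁻¹ * y * x) ^ m = x⁻¹ * y ^ m * x := by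
  simpa only [inv_inv] using conj_zpow (i := m) (a := x⁻¹) (b := y)

end GroupTheory

instance freeLCS_normal (n q : ℕ) : (freeLCS n q).Normal := by
  unfold freeLCS; infer_instance

theorem freeLCS_commutator_le (n k : ℕ) :
    ⁅freeLCS n (k + 1), (⊤ : Subgroup (FreeGroup (Fin n)))⁆ ≤ freeLCS n (k + 2) :=
  lowerCentralSeries_commutator_le k

/-! ### Base points in `P₀` and the letters of over-arcs. -/

namespace VirtualLinkDiagram

variable {n : ℕ} {D : VirtualLinkDiagram n}

theorem overPoint_spec {x : StrandPoint n} (hx : x ∈ D.under) :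
    D.overPoint x ≠ x ∧ D.curve (D.overPoint x) = D.curve x := by
  have h := D.under_double x hx
  unfold overPoint
  rw [dif_pos h]
  exact h.choose_spec

theorem isClassical_overPoint {x : StrandPoint n} (hx : x ∈ D.under) :
    D.IsClassical (D.overPoint x) :=
  Or.inr ⟨x, hx, (overPoint_spec hx).1.symm, (overPoint_spec hx).2.symm⟩

namespace ArcNumbering

variable (N : D.ArcNumbering)

theorem crossingPoint_under (i : Fin n) (j : ℕ) : (i, N.crossingPoint i j) ∈ D.under := by
  unfold crossingPoint
  set l := ((D.underPoints i).image (travel (N.start i))).sort (· ≤ ·)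
  by_cases hj : j - 1 < l.length
  · rw [List.getD_eq_getElem _ _ hj]
    obtain ⟨x, hx, hxe⟩ := Finset.mem_image.1 ((Finset.mem_sort _).1 (List.getElem_mem hj))
    rw [show l[j - 1] = _ from hxe.symm, coe_travel]
    simpa [underPoints] using hx
  -- An out-of-range index takes the default `1`, a full turn, which is again the start of `a_{i1}`.
  · rw [List.getD_eq_default _ _ (not_lt.1 hj), AddCircle.coe_period, add_zero]
    exact N.start_under i

/-- A letter `b` would put a classical crossing between the start of the arc and the base point,
which `P₀` forbids. -/
theorem arcLetter_eq_of_underStarting {p : D.BasePointSystem} (hp : p ∈ D.underStarting)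
    {y : StrandPoint n} (hy : D.IsClassical y) :
    N.arcLetter p y = .a y.1 ⟨N.arcIndex y.1 y.2, N.arcIndex_mem y.1 y.2⟩ := by
  unfold arcLetter
  refine if_neg ?_
  rintro ⟨hidx, hlt⟩
  obtain ⟨i, y⟩ := y
  obtain ⟨c, hc, hcp⟩ := hp i
  refine hcp y hy ?_
  dsimp only at hidx hlt
  -- Cut the circle at the start of `a_{i1}`. If `c` is not before the base point, travel from `c`
  -- crosses the cut and then meets `y` first.
  rcases le_or_gt (travel (N.start i) (p.point i)) (travel (N.start i) c) with h | h
  · rw [travel_eq_sub_add_one_of_le h, travel_eq_sub_add_one_of_le (hlt.le.trans h)]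
    linarith
  have hcy : travel (N.start i) c < travel (N.start i) y := by
    -- Otherwise `c` is counted in the arc index of the base point but not in that of `y`.
    by_contra hcy
    have hlt' : N.arcIndex i y < N.baseIndex p i := by
      refine Nat.add_lt_add_right (Finset.card_lt_card ?_) 1
      refine Finset.ssubset_iff_of_subset (fun x hx => ?_) |>.2 ⟨c, ?_, ?_⟩
      · rw [Finset.mem_filter] at hx ⊢
        exact ⟨hx.1, hx.2.trans hlt⟩
      · rw [Finset.mem_filter]
        exact ⟨by simpa [underPoints] using hc, h⟩
      · rw [Finset.mem_filter, not_and]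
        exact fun _ => hcy
    exact hlt'.ne hidx
  rw [travel_eq_sub_of_lt h, travel_eq_sub_of_lt hcy]
  linarith

theorem overLetter_of_underStarting {p : D.BasePointSystem} (hp : p ∈ D.underStarting)
    (i : Fin n) (j : ℕ) :
    N.overLetter p i j = .a (D.overPoint (i, N.crossingPoint i j)).1
      ⟨N.arcIndex _ (D.overPoint (i, N.crossingPoint i j)).2, N.arcIndex_mem _ _⟩ :=
  N.arcLetter_eq_of_underStarting hp (isClassical_overPoint (N.crossingPoint_under i j))

theorem segmentWord_eq_of_underStarting {p p' : D.BasePointSystem} (hp : p ∈ D.underStarting)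
    (hp' : p' ∈ D.underStarting) (i : Fin n) (j k : ℕ) :
    N.segmentWord p i j k = N.segmentWord p' i j k := by
  simp only [segmentWord, N.overLetter_of_underStarting hp, N.overLetter_of_underStarting hp']

/-! ### Words along a component and erasure of base points. -/

variable (p : D.BasePointSystem)

theorem baseIndex_mem (i : Fin n) : N.baseIndex p i ∈ Finset.Icc 1 (D.numArcs i) :=
  N.arcIndex_mem i (p.point i)

theorem one_le_baseIndex (i : Fin n) : 1 ≤ N.baseIndex p i :=
  (Finset.mem_Icc.1 (N.baseIndex_mem p i)).1

theorem baseIndex_le (i : Fin n) : N.baseIndex p i ≤ D.numArcs i :=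
  (Finset.mem_Icc.1 (N.baseIndex_mem p i)).2

theorem segmentWord_mul (i : Fin n) {j k l : ℕ} (hjk : j ≤ k + 1) (hkl : k ≤ l) :
    N.segmentWord p i j k * N.segmentWord p i (k + 1) l = N.segmentWord p i j l := by
  unfold segmentWord
  rw [← List.prod_append, ← List.map_append,
    List.Ico.append_consecutive hjk (Nat.add_le_add_right hkl 1)]

theorem segmentWord_of_lt (i : Fin n) {j k : ℕ} (h : k < j) : N.segmentWord p i j k = 1 := by
  unfold segmentWord
  rw [List.Ico.eq_nil_of_le h]
  rfl

/-- The homomorphism that replaces each letter `b i` by the letter of the arc of `D` which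
contains the base point of the `i`th component. -/
noncomputable def forgetBase : FreeGroup D.Letter →* FreeGroup D.Letter :=
  FreeGroup.lift fun
    | .a i j => FreeGroup.of (.a i j)
    | .b i => FreeGroup.of (.a i ⟨N.baseIndex p i, N.baseIndex_mem p i⟩)

@[simp]
theorem forgetBase_a (i : Fin n) (j : Finset.Icc 1 (D.numArcs i)) :
    N.forgetBase p (FreeGroup.of (.a i j)) = FreeGroup.of (.a i j) := by
  simp [forgetBase]

@[simp]
theorem forgetBase_b (i : Fin n) :
    N.forgetBase p (FreeGroup.of (.b i)) =
      FreeGroup.of (.a i ⟨N.baseIndex p i, N.baseIndex_mem p i⟩) := by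
  simp [forgetBase]

theorem forgetBase_arcLetter {p p₀ : D.BasePointSystem}
    (h : ∀ k, N.baseIndex p₀ k = N.baseIndex p k) (y : StrandPoint n) :
    N.forgetBase p₀ (FreeGroup.of (N.arcLetter p y)) =
      FreeGroup.of (.a y.1 ⟨N.arcIndex y.1 y.2, N.arcIndex_mem y.1 y.2⟩) := by
  unfold arcLetter
  split_ifs with hy
  · simp only [forgetBase_b, h, hy.1]
  · simp

theorem forgetBase_segmentWord {p p₀ pstar : D.BasePointSystem} (hs : pstar ∈ D.underStarting)
    (h : ∀ k, N.baseIndex p₀ k = N.baseIndex p k) (i : Fin n) (j k : ℕ) :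
    N.forgetBase p₀ (N.segmentWord p i j k) = N.segmentWord pstar i j k := by
  unfold segmentWord
  rw [map_list_prod, List.map_map]
  congr 2
  funext s
  rw [Function.comp_apply, map_zpow, N.overLetter_of_underStarting hs, overLetter,
    N.forgetBase_arcLetter h]

theorem forgetBase_partialLongitude_of_le {p p₀ pstar : D.BasePointSystem}
    (hs : pstar ∈ D.underStarting) (h : ∀ k, N.baseIndex p₀ k = N.baseIndex p k) (i : Fin n)
    {j : ℕ} (hj : N.baseIndex p i ≤ j) :
    N.forgetBase p₀ (N.partialLongitude p i j) =
      (N.segmentWord pstar i 1 (N.baseIndex p i - 1))⁻¹ * N.segmentWord pstar i 1 j := by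
  have h1 := N.one_le_baseIndex p i
  have h2 := N.segmentWord_mul pstar i (j := 1) (k := N.baseIndex p i - 1) (l := j)
    (by omega) (by omega)
  rw [Nat.sub_add_cancel h1] at h2
  rw [partialLongitude, if_pos hj, N.forgetBase_segmentWord hs h, ← h2, inv_mul_cancel_left]

/-- Here the path from the base point passes the start of `a_{i1}`, so a whole longitude word
appears in the middle. -/
theorem forgetBase_partialLongitude_of_lt {p p₀ pstar : D.BasePointSystem}
    (hs : pstar ∈ D.underStarting) (h : ∀ k, N.baseIndex p₀ k = N.baseIndex p k) (i : Fin n)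
    {j : ℕ} (hj : j < N.baseIndex p i) :
    N.forgetBase p₀ (N.partialLongitude p i j) =
      (N.segmentWord pstar i 1 (N.baseIndex p i - 1))⁻¹ *
        N.segmentWord pstar i 1 (D.numArcs i) * N.segmentWord pstar i 1 j := by
  have h1 := N.one_le_baseIndex p i
  have h3 := N.baseIndex_le p i
  have h2 := N.segmentWord_mul pstar i (j := 1) (k := N.baseIndex p i - 1) (l := D.numArcs i)
    (by omega) (by omega)
  rw [Nat.sub_add_cancel h1] at h2
  rw [partialLongitude, if_neg hj.not_ge, map_mul, N.forgetBase_segmentWord hs h,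
    N.forgetBase_segmentWord hs h, ← h2, inv_mul_cancel_left]

/-! ### Recursion and stabilisation of `η_q` and `φ_q`. -/

theorem eta_one_a (i : Fin n) (j : Finset.Icc 1 (D.numArcs i)) :
    N.eta p 1 (FreeGroup.of (.a i j)) = FreeGroup.of i := by
  simp [eta]

theorem eta_succ_a (k : ℕ) (i : Fin n) (j : Finset.Icc 1 (D.numArcs i)) :
    N.eta p (k + 2) (FreeGroup.of (.a i j)) = if j.1 = N.baseIndex p i then FreeGroup.of i else
      (N.eta p (k + 1) (N.partialLongitude p i (j.1 - 1)))⁻¹ * FreeGroup.of i *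
        N.eta p (k + 1) (N.partialLongitude p i (j.1 - 1)) := by
  simp [eta]

theorem eta_succ_b (k : ℕ) (i : Fin n) :
    N.eta p (k + 2) (FreeGroup.of (.b i)) =
      (N.eta p (k + 1) (N.partialLongitude p i (N.baseIndex p i - 1)))⁻¹ * FreeGroup.of i *
        N.eta p (k + 1) (N.partialLongitude p i (N.baseIndex p i - 1)) := by
  simp [eta]

theorem phi_succ (k : ℕ) (i : Fin n) :
    N.phi p (k + 2) (FreeGroup.of i) =
      N.eta p (k + 1) (N.connectingWord p i) * FreeGroup.of i *
        (N.eta p (k + 1) (N.connectingWord p i))⁻¹ := by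
  simp [phi]

theorem eta_baseIndex (k : ℕ) (i : Fin n) (j : Finset.Icc 1 (D.numArcs i))
    (hj : j.1 = N.baseIndex p i) :
    N.eta p (k + 1) (FreeGroup.of (.a i j)) = FreeGroup.of i := by
  cases k with
  | zero => exact N.eta_one_a p i j
  | succ k => rw [eta_succ_a, if_pos hj]

/-- With base index `1` the exceptional case `j = 1` is conjugation by the empty word, so one
formula covers all arcs. -/
theorem eta_succ_a_of_baseIndex_eq_one {pstar : D.BasePointSystem} {i : Fin n}
    (hi : N.baseIndex pstar i = 1) (k : ℕ) (j : Finset.Icc 1 (D.numArcs i)) :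
    N.eta pstar (k + 2) (FreeGroup.of (.a i j)) =
      (N.eta pstar (k + 1) (N.segmentWord pstar i 1 (j.1 - 1)))⁻¹ * FreeGroup.of i *
        N.eta pstar (k + 1) (N.segmentWord pstar i 1 (j.1 - 1)) := by
  have hj := (Finset.mem_Icc.1 j.2).1
  rw [eta_succ_a, hi]
  split_ifs with h
  · simp [h, segmentWord_of_lt]
  · rw [partialLongitude, hi, if_pos (by omega)]

theorem eta_mod_lowerCentralSeries (k : ℕ) (x : FreeGroup D.Letter) :
    mk' (freeLCS n (k + 1)) (N.eta p (k + 2) x) = mk' (freeLCS n (k + 1)) (N.eta p (k + 1) x) := by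
  induction k generalizing x with
  | zero => exact QuotientGroup.eq.2 (mem_top _)
  | succ k ih =>
    refine DFunLike.congr_fun (f := (mk' (freeLCS n (k + 2))).comp (N.eta p (k + 3)))
      (g := (mk' (freeLCS n (k + 2))).comp (N.eta p (k + 2))) (FreeGroup.ext_hom _ _ ?_) x
    rintro (⟨i, j⟩ | i)
    · rw [MonoidHom.comp_apply, MonoidHom.comp_apply, eta_succ_a, eta_succ_a]
      split_ifs
      · rfl
      · exact mk_conj_eq_of_commutator_le (freeLCS_commutator_le n k) (ih _) _
    · rw [MonoidHom.comp_apply, MonoidHom.comp_apply, eta_succ_b, eta_succ_b]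
      exact mk_conj_eq_of_commutator_le (freeLCS_commutator_le n k) (ih _) _

theorem phi_mod_lowerCentralSeries (k : ℕ) (x : FreeGroup (Fin n)) :
    mk' (freeLCS n (k + 1)) (N.phi p (k + 2) x) = mk' (freeLCS n (k + 1)) (N.phi p (k + 1) x) := by
  cases k with
  | zero => exact QuotientGroup.eq.2 (mem_top _)
  | succ k =>
    refine DFunLike.congr_fun (f := (mk' (freeLCS n (k + 2))).comp (N.phi p (k + 3)))
      (g := (mk' (freeLCS n (k + 2))).comp (N.phi p (k + 2))) (FreeGroup.ext_hom _ _ fun i => ?_) x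
    rw [MonoidHom.comp_apply, MonoidHom.comp_apply, phi_succ, phi_succ]
    have := mk_conj_eq_of_commutator_le (freeLCS_commutator_le n k)
      (N.eta_mod_lowerCentralSeries p k (N.connectingWord p i)⁻¹) (FreeGroup.of i)
    simpa only [map_inv, inv_inv] using this

/-! ### The subgroups `A_q M_q^p` and commutation with the longitude. -/

instance relSubgroup_normal (pstar p : D.BasePointSystem) (q : ℕ) :
    (N.relSubgroup pstar q p).Normal :=
  normalClosure_normal

theorem relator_mem (pstar : D.BasePointSystem) (q : ℕ) (i : Fin n) :
    N.phi p q (FreeGroup.of i * N.eta pstar q (N.longitude pstar i) * (FreeGroup.of i)⁻¹ *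
      (N.eta pstar q (N.longitude pstar i))⁻¹) ∈ N.relSubgroup pstar q p :=
  subset_normalClosure ⟨i, _, rfl, rfl⟩

/-- The subgroup `A_{k+1} M_{k+1}^p` modulo which longitudes are compared. -/
def modulus (pstar p : D.BasePointSystem) (k : ℕ) : Subgroup (FreeGroup (Fin n)) :=
  freeLCS n (k + 1) ⊔ N.relSubgroup pstar (k + 1) p

instance modulus_normal (pstar p : D.BasePointSystem) (k : ℕ) : (N.modulus pstar p k).Normal := by
  unfold modulus; infer_instance

theorem freeLCS_le_modulus (pstar : D.BasePointSystem) (k : ℕ) :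
    freeLCS n (k + 1) ≤ N.modulus pstar p k := le_sup_left

/-- Raising the index of both `η` and `φ` changes a relator only by an element of `A_{k+1}`. -/
theorem modulus_le (pstar : D.BasePointSystem) (k : ℕ) :
    N.modulus pstar p k ≤ freeLCS n (k + 1) ⊔ N.relSubgroup pstar (k + 2) p := by
  refine sup_le le_sup_left (normalClosure_le_normal ?_)
  rintro _ ⟨i, _, rfl, rfl⟩
  set c : FreeGroup (Fin n) → FreeGroup (Fin n) :=
    fun g => FreeGroup.of i * g * (FreeGroup.of i)⁻¹ * g⁻¹
  have h1 : mk' (freeLCS n (k + 1)) (c (N.eta pstar (k + 2) (N.longitude pstar i))) =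
      mk' (freeLCS n (k + 1)) (c (N.eta pstar (k + 1) (N.longitude pstar i))) := by
    simp only [c, map_mul, map_inv, N.eta_mod_lowerCentralSeries pstar k (N.longitude pstar i)]
  have h2 := (lowerCentralSeries_mk_map_eq (N.phi p (k + 2)) h1).trans
    (N.phi_mod_lowerCentralSeries p k _)
  have h3 := QuotientGroup.eq.1 h2
  have h4 : N.phi p (k + 2) (c (N.eta pstar (k + 2) (N.longitude pstar i))) ∈
      freeLCS n (k + 1) ⊔ N.relSubgroup pstar (k + 2) p :=
    mem_sup_right (N.relator_mem p pstar (k + 2) i)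
  have h5 := mul_mem h4 (mem_sup_left h3)
  rwa [mul_inv_cancel_left] at h5

theorem modulus_commutator_le (pstar : D.BasePointSystem) (k : ℕ) :
    ⁅N.modulus pstar p k, (⊤ : Subgroup (FreeGroup (Fin n)))⁆ ≤ N.modulus pstar p (k + 1) := by
  refine (commutator_mono (N.modulus_le p pstar k) le_rfl).trans (commutator_le.2 ?_)
  intro g hg h _
  obtain ⟨y, hy, z, hz, rfl⟩ := mem_sup_of_normal_right.1 hg
  have hz' : mk' (N.modulus pstar p (k + 1)) z = 1 :=
    (QuotientGroup.eq_one_iff z).2 (mem_sup_right hz)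
  have hy' : mk' (N.modulus pstar p (k + 1)) ⁅y, h⁆ = 1 :=
    (QuotientGroup.eq_one_iff _).2 (mem_sup_left (freeLCS_commutator_le n k
      (commutator_mem_commutator hy (mem_top h))))
  refine (QuotientGroup.eq_one_iff _).1 (?_ : mk' (N.modulus pstar p (k + 1)) ⁅y * z, h⁆ = 1)
  rw [map_commutatorElement, map_mul, hz', mul_one, ← map_commutatorElement, hy']

theorem partialLongitude_of_baseIndex_eq_one {pstar : D.BasePointSystem} {i : Fin n}
    (hi : N.baseIndex pstar i = 1) :
    N.partialLongitude pstar i 0 = N.segmentWord pstar i 1 (D.numArcs i) := by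
  rw [partialLongitude, hi, if_neg (by omega), N.segmentWord_of_lt pstar i zero_lt_one, mul_one]

theorem commute_phi_longitude {pstar : D.BasePointSystem} {i : Fin n}
    (hi : N.baseIndex pstar i = 1) (k : ℕ) :
    Commute (mk' (N.modulus pstar p (k + 1)) (N.phi p (k + 2) (FreeGroup.of i)))
      (mk' (N.modulus pstar p (k + 1)) (N.phi p (k + 2)
        (N.eta pstar (k + 1) (N.segmentWord pstar i 1 (D.numArcs i))))) := by
  set π := (mk' (N.modulus pstar p (k + 1))).comp (N.phi p (k + 2))
  have h1 : Commute (π (FreeGroup.of i)) (π (N.eta pstar (k + 2) (N.longitude pstar i))) := by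
    have : π _ = 1 := (QuotientGroup.eq_one_iff _).2 (mem_sup_right
      (N.relator_mem p pstar (k + 2) i))
    simp only [map_mul, map_inv] at this
    exact mul_inv_eq_iff_eq_mul.1 (mul_inv_eq_one.1 this)
  have h2 : Commute (π (FreeGroup.of i))
      (π (N.eta pstar (k + 2) (N.segmentWord pstar i 1 (D.numArcs i)))) := by
    -- The framing factor maps to a power of `α_i`, which commutes with `α_i` and can be stripped
    -- off.
    rw [longitude, map_mul, map_zpow, N.eta_baseIndex pstar (k + 1) i _ rfl, hi, Nat.sub_self,
      N.partialLongitude_of_baseIndex_eq_one hi, map_mul, map_zpow] at h1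
    have h3 := ((Commute.refl (π (FreeGroup.of i))).zpow_right (D.selfWrithe i)).mul_right h1
    rwa [← mul_assoc, ← zpow_add, add_neg_cancel, zpow_zero, one_mul] at h3
  -- The two values of `η` agree only modulo `A_{k+1}`, but their commutators with `α_i` agree
  -- modulo `A_{k+2}`.
  have h4 : mk' (freeLCS n (k + 2)) (FreeGroup.of i *
        N.eta pstar (k + 2) (N.segmentWord pstar i 1 (D.numArcs i)) * (FreeGroup.of i)⁻¹ *
        (N.eta pstar (k + 2) (N.segmentWord pstar i 1 (D.numArcs i)))⁻¹) =
      mk' (freeLCS n (k + 2)) (FreeGroup.of i *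
        N.eta pstar (k + 1) (N.segmentWord pstar i 1 (D.numArcs i)) * (FreeGroup.of i)⁻¹ *
        (N.eta pstar (k + 1) (N.segmentWord pstar i 1 (D.numArcs i)))⁻¹) := by
    have := mk_conj_eq_of_commutator_le (freeLCS_commutator_le n k)
      (N.eta_mod_lowerCentralSeries pstar k (N.segmentWord pstar i 1 (D.numArcs i))⁻¹)
      (FreeGroup.of i)⁻¹
    simp only [map_inv, map_mul, inv_inv] at this ⊢
    simp only [mul_assoc] at this ⊢
    rw [this]
  have h5 := mk_eq_mk_of_le (N.freeLCS_le_modulus p pstar (k + 1))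
    (lowerCentralSeries_mk_map_eq (N.phi p (k + 2)) h4)
  change π _ = π _ at h5
  change π _ * π _ = π _ * π _
  simp only [map_mul, map_inv] at h5
  rw [h2.eq, mul_inv_cancel_right, mul_inv_cancel] at h5
  exact mul_inv_eq_iff_eq_mul.1 (mul_inv_eq_one.1 h5.symm)

/-! ### Comparison of base point systems. -/

variable {N} in
theorem eta_mod_modulus {pstar p₀ : D.BasePointSystem} (hs : N.IsReference pstar)
    (k : ℕ) {p : D.BasePointSystem}
    (h : ∀ i, N.baseIndex p₀ i = N.baseIndex p i) (x : FreeGroup D.Letter) :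
    mk' (N.modulus pstar p₀ k) (N.eta p (k + 1) x) =
      mk' (N.modulus pstar p₀ k)
        (N.phi p₀ (k + 1) (N.eta pstar (k + 1) (N.forgetBase p₀ x))) := by
  induction k generalizing p x with
  -- `A_1` is the whole group.
  | zero => exact QuotientGroup.eq.2 (mem_sup_left (mem_top _))
  | succ k ih =>
    set Φ := (N.phi p₀ (k + 2)).comp (N.eta pstar (k + 1)) with hΦ
    set π := mk' (N.modulus pstar p₀ (k + 1))
    have key : ∀ {p : D.BasePointSystem}, (∀ i, N.baseIndex p₀ i = N.baseIndex p i) →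
        ∀ x, mk' (N.modulus pstar p₀ k) (N.eta p (k + 1) x) =
          mk' (N.modulus pstar p₀ k) (Φ (N.forgetBase p₀ x)) := fun h x =>
      (ih h x).trans (mk_eq_mk_of_le (N.freeLCS_le_modulus p₀ pstar k)
        (N.phi_mod_lowerCentralSeries p₀ k _)).symm
    have conj : ∀ {p : D.BasePointSystem}, (∀ i, N.baseIndex p₀ i = N.baseIndex p i) →
        ∀ x a, π ((N.eta p (k + 1) x)⁻¹ * a * N.eta p (k + 1) x) =
          π ((Φ (N.forgetBase p₀ x))⁻¹ * a * Φ (N.forgetBase p₀ x)) := fun h x a =>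
      mk_conj_eq_of_commutator_le (N.modulus_commutator_le p₀ pstar k) (key h x) a
    -- `φ^{p₀}` is defined through `η^{p₀}`, so the induction hypothesis is needed for `p₀` itself;
    -- hence the induction over all `p`.
    have hphi : ∀ i, π (N.phi p₀ (k + 2) (FreeGroup.of i)) =
        π (Φ (N.segmentWord pstar i 1 (N.baseIndex p i - 1))) * π (FreeGroup.of i) *
          (π (Φ (N.segmentWord pstar i 1 (N.baseIndex p i - 1))))⁻¹ := by
      intro i
      have := conj (fun _ => rfl) (N.connectingWord p₀ i)⁻¹ (FreeGroup.of i)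
      rw [connectingWord, map_inv (N.forgetBase p₀),
        N.forgetBase_segmentWord hs.1 fun _ => rfl, h i] at this
      rw [phi_succ, connectingWord, h i]
      simpa only [map_inv, map_mul, inv_inv] using this
    have hstar : ∀ i (j : Finset.Icc 1 (D.numArcs i)),
        π (N.phi p₀ (k + 2) (N.eta pstar (k + 2) (FreeGroup.of (.a i j)))) =
          (π (Φ (N.segmentWord pstar i 1 (j.1 - 1))))⁻¹ * π (N.phi p₀ (k + 2) (FreeGroup.of i)) *
            π (Φ (N.segmentWord pstar i 1 (j.1 - 1))) := by
      intro i j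
      rw [N.eta_succ_a_of_baseIndex_eq_one (hs.2 i)]
      simp only [map_mul, map_inv, hΦ, MonoidHom.comp_apply]
    have hbase : ∀ i (j : Finset.Icc 1 (D.numArcs i)), j.1 = N.baseIndex p i →
        π (N.phi p₀ (k + 2) (N.eta pstar (k + 2) (FreeGroup.of (.a i j)))) =
          π (FreeGroup.of i) := by
      intro i j hj
      rw [hstar, hphi, hj]
      group
    have hcomm : ∀ i, (π (Φ (N.segmentWord pstar i 1 (D.numArcs i))))⁻¹ *
        π (N.phi p₀ (k + 2) (FreeGroup.of i)) * π (Φ (N.segmentWord pstar i 1 (D.numArcs i))) =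
          π (N.phi p₀ (k + 2) (FreeGroup.of i)) := by
      intro i
      have : _ * _ = _ * _ := N.commute_phi_longitude p₀ (hs.2 i) k
      rw [mul_assoc]
      exact inv_mul_eq_iff_eq_mul.2 this
    -- The full turn in the middle is absorbed by `hcomm`.
    have hlt : ∀ i j, j < N.baseIndex p i →
        π ((N.eta p (k + 1) (N.partialLongitude p i j))⁻¹ * FreeGroup.of i *
          N.eta p (k + 1) (N.partialLongitude p i j)) =
        (π (Φ (N.segmentWord pstar i 1 j)))⁻¹ * π (N.phi p₀ (k + 2) (FreeGroup.of i)) *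
          π (Φ (N.segmentWord pstar i 1 j)) := by
      intro i j hj
      rw [conj h, N.forgetBase_partialLongitude_of_lt hs.1 h i hj, ← hcomm, hphi]
      simp only [map_mul, map_inv, mul_inv_rev, inv_inv, mul_assoc]
    refine DFunLike.congr_fun (f := π.comp (N.eta p (k + 2)))
      (g := π.comp ((N.phi p₀ (k + 2)).comp ((N.eta pstar (k + 2)).comp (N.forgetBase p₀))))
      (FreeGroup.ext_hom _ _ ?_) x
    rintro (⟨i, j⟩ | i)
    · simp only [MonoidHom.comp_apply, forgetBase_a]
      rw [eta_succ_a]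
      split_ifs with hj
      · exact (hbase i j hj).symm
      rw [hstar]
      rcases le_or_gt (N.baseIndex p i) (j.1 - 1) with hle | hgt
      · rw [conj h, N.forgetBase_partialLongitude_of_le hs.1 h i hle, hphi]
        simp only [map_mul, map_inv, mul_inv_rev, inv_inv, mul_assoc]
      · exact hlt i _ hgt
    · simp only [MonoidHom.comp_apply, forgetBase_b]
      have h1 := N.one_le_baseIndex p i
      rw [eta_succ_b, hlt i _ (by omega), hbase i _ (h i), hphi]
      group

variable {N} in
theorem longitude_mod_modulus {pstar p p₀ : D.BasePointSystem} (hs : N.IsReference pstar)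
    (hp₀ : p₀ ∈ D.underStarting) (h : ∀ i, N.baseIndex p₀ i = N.baseIndex p i) (k : ℕ)
    (i : Fin n) :
    mk' (N.modulus pstar p₀ k) (N.eta p (k + 1) (N.longitude p i)) =
      mk' (N.modulus pstar p₀ k) (N.phi p₀ (k + 1) (N.eta pstar (k + 1)
        ((N.connectingWord p₀ i)⁻¹ * N.longitude pstar i * N.connectingWord p₀ i))) := by
  rw [eta_mod_modulus hs k h]
  refine mk_eq_mk_of_le (N.freeLCS_le_modulus p₀ pstar k)
    (lowerCentralSeries_mk_map_eq (N.phi p₀ (k + 1)) ?_)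
  have h1 := N.one_le_baseIndex p i
  -- At level `k + 2` the arc letter is a conjugate by a level `k + 1` value; modulo `A_{k+1}` this
  -- also describes its level `k + 1` value.
  have ha := N.eta_mod_lowerCentralSeries pstar k
    (FreeGroup.of (.a i ⟨N.baseIndex p i, N.baseIndex_mem p i⟩))
  rw [N.eta_succ_a_of_baseIndex_eq_one (hs.2 i)] at ha
  have hc : N.connectingWord p₀ i = N.segmentWord pstar i 1 (N.baseIndex p i - 1) := by
    rw [connectingWord, N.segmentWord_eq_of_underStarting hp₀ hs.1, h]
  have hl : N.partialLongitude pstar i (N.baseIndex pstar i - 1) =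
      N.segmentWord pstar i 1 (D.numArcs i) := by
    rw [hs.2 i, Nat.sub_self, N.partialLongitude_of_baseIndex_eq_one (hs.2 i)]
  have hb := N.eta_baseIndex pstar k i ⟨N.baseIndex pstar i, N.baseIndex_mem pstar i⟩ rfl
  rw [hc, longitude, longitude, map_mul (N.forgetBase p₀), map_zpow (N.forgetBase p₀),
    forgetBase_a, N.forgetBase_partialLongitude_of_lt hs.1 h i (by omega), hl]
  change mk' (freeLCS n (k + 1)) _ = mk' (freeLCS n (k + 1)) _
  simp only [map_mul, map_inv, map_zpow] at ha ⊢
  rw [← ha, hb, inv_mul_mul_zpow]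
  group

end ArcNumbering
end VirtualLinkDiagram

theorem mainTheorem6 {n : ℕ} (D : VirtualLinkDiagram n) (N : D.ArcNumbering)
    (pstar : D.BasePointSystem) (hstar : N.IsReference pstar)
    (p p₀ : D.BasePointSystem) (hp₀ : p₀ ∈ D.underStarting)
    (hpp₀ : ∀ k, N.baseIndex p₀ k = N.baseIndex p k)
    (q : ℕ) (hq : 1 ≤ q) (i : Fin n) :
    CongrMod (freeLCS n q ⊔ N.relSubgroup pstar q p₀)
      (N.eta p q (N.longitude p i))
      (N.phi p₀ q (N.eta pstar q
        ((N.connectingWord p₀ i)⁻¹ * N.longitude pstar i * N.connectingWord p₀ i))) ∧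
    CongrMod (freeLCS n q ⊔ N.totalRelSubgroup pstar q)
      (N.eta p q (N.longitude p i))
      (N.phi p₀ q (N.eta pstar q
        ((N.connectingWord p₀ i)⁻¹ * N.longitude pstar i * N.connectingWord p₀ i))) := by
  obtain ⟨k, rfl⟩ : ∃ k, q = k + 1 := ⟨q - 1, by omega⟩
  have h : CongrMod (freeLCS n (k + 1) ⊔ N.relSubgroup pstar (k + 1) p₀) _ _ :=
    QuotientGroup.eq.1
      (VirtualLinkDiagram.ArcNumbering.longitude_mod_modulus hstar hp₀ hpp₀ k i)
  have hle : N.relSubgroup pstar (k + 1) p₀ ≤ N.totalRelSubgroup pstar (k + 1) :=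
    le_iSup₂_of_le p₀ hp₀ le_rfl
  exact ⟨h, sup_le_sup_left hle _ h⟩
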